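/- Setting. A uniform grid tiles a closed axis-parallel rectangle \(R\subset\mathbb R^2\) by finitely many congruent closed rectangular boxes. Let \(\kappa\subseteq\Omega\subseteq R\), where \(\kappa\) is the set of obstacles, and suppose that the obstacle-free region \(\Omega\setminus\kappa\) is relatively open in \(R\) (for example, \(\Omega=R\) and \(\kappa\) is closed). The discretization \(\mathcal D\) of \(\Omega\) by the grid has as its cells \(1,\dots,K\) the boxes that meet \(\Omega\). A cell is blocked if it is not contained in \(\Omega\setminus\kappa\). Finitely many robots \(p_1,\dots,p_N\in\Omega\) and targets \(r_1,\dots,r_M\in\Omega\) are points, each of which lies in exactly one cell of \(\mathcal D\). For a discretization with \(K\) cells, let \(\mu_k=0\) if cell \(k\) contains a target and \(\mu_k=1\) otherwise, and let \(\nu_k=0\) if cell \(k\) contains a robot and \(\nu_k=1\) otherwise. A cost matrix is any \(C\in[0,\infty]^{K\times K}\) with \(c_{ii}=0\); \(c_{ij}\le 1\) if \(i,j\) are unblocked cells that share an edge; and \(c_{ij}>1\) if the cells \(i,j\) neither coincide nor share an edge or a corner, or if \(i\ne j\) and \(j\) is blocked. The discretization is practically feasible for \(C\) if there is a matrix \(\Pi\in\{0,1\}^{K\times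 K}\) such that (i) \(\sum_{i,j}\pi_{ij}c_{ij}<\infty\) (with \(0\cdot\infty=0\)); (ii) \(\Pi\mathbf 1\le\mu\), \(\mathbf 1^\top\Pi\le\nu^\top\) and \(\mathbf 1^\top\Pi\mathbf 1=\min(\|\mu\|_1,\|\nu\|_1)\), and, if \(N=M\), \(\Pi\mathbf 1=\mu\) and \(\mathbf 1^\top\Pi=\nu^\top\); (iii) \(c_{ij}\le 1\) whenever \(\pi_{ij}=1\). Lemma. Suppose that for every robot \(n\) and every target \(m\) there is a continuous path in \(\Omega\setminus\kappa\) from \(p_n\) to \(r_m\) that meets neither \(p_{n'}\) for \(n'\ne n\) nor \(r_{m'}\) for \(m'\neq m\). Then there is an integer \(k>1\) such that the discretization obtained by dividing each box of the grid into \(k\times k\) congruent boxes has the following properties: each robot and each target lies in exactly one cell, no cell contains two different points among the robots and targets, and the discretization is practically feasible for every cost matrix \(C\). -/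

import Mathlib

open scoped ENNReal

noncomputable section

/-- A uniform grid of `cols * rows` congruent closed rectangular cells in the plane. -/
structure UniformGrid where
  /-- the lower left corner of the grid -/
  origin : ℝ × ℝ
  /-- the common width of the cells -/
  width : ℝ
  /-- the common height of the cells -/
  height : ℝ
  width_pos : 0 < width
  height_pos : 0 < height
  /-- the number of columns -/
  cols : ℕ
  /-- the number of rows -/
  rows : ℕ

namespace UniformGrid

/-- The closed rectangle in column `c.1` and row `c.2`. -/
def box (D : UniformGrid) (c : Fin D.cols × Fin D.rows) : Set (ℝ × ℝ) :=
  Set.Icc (D.origin.1 + (c.1 : ℝ) * D.width) (D.origin.1 + ((c.1 : ℝ) + 1) * D.width) ×ˢ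
    Set.Icc (D.origin.2 + (c.2 : ℝ) * D.height) (D.origin.2 + ((c.2 : ℝ) + 1) * D.height)

/-- The closed rectangle that the whole grid covers. -/
def region (D : UniformGrid) : Set (ℝ × ℝ) := ⋃ c, D.box c

/-- The finer uniform grid in which every cell is divided into `k * k` congruent cells. -/
def subdivide (D : UniformGrid) (k : ℕ) (hk : 0 < k) : UniformGrid where
  origin := D.origin
  width := D.width / k
  height := D.height / k
  width_pos := div_pos D.width_pos (Nat.cast_pos.mpr hk)
  height_pos := div_pos D.height_pos (Nat.cast_pos.mpr hk)
  cols := D.cols * k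
  rows := D.rows * k

/-- The cells of the discretization of `Ω` by the grid: the boxes of the grid that meet `Ω`
(all boxes, if `Ω` is the rectangle that the grid covers). -/
def Cell (D : UniformGrid) (Ω : Set (ℝ × ℝ)) : Type :=
  {c : Fin D.cols × Fin D.rows // (D.box c ∩ Ω).Nonempty}

instance (D : UniformGrid) (Ω : Set (ℝ × ℝ)) : Finite (D.Cell Ω) :=
  inferInstanceAs (Finite {c : Fin D.cols × Fin D.rows // (D.box c ∩ Ω).Nonempty})

instance (D : UniformGrid) (Ω : Set (ℝ × ℝ)) : Fintype (D.Cell Ω) := Fintype.ofFinite _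

variable {D : UniformGrid} {Ω : Set (ℝ × ℝ)}

/-- The set of points of a cell. -/
def Cell.carrier (i : D.Cell Ω) : Set (ℝ × ℝ) := D.box i.1

/-- A cell is blocked if it meets an obstacle or sticks out of `Ω`. -/
def Cell.Blocked (κ : Set (ℝ × ℝ)) (i : D.Cell Ω) : Prop := ¬ i.carrier ⊆ Ω \ κ

/-- Two different cells that share an edge. -/
def Cell.ShareEdge (i j : D.Cell Ω) : Prop :=
  ((i.1.1 : ℤ) - (j.1.1 : ℤ)).natAbs + ((i.1.2 : ℤ) - (j.1.2 : ℤ)).natAbs = 1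

/-- Two cells that are equal, share an edge or share a corner. -/
def Cell.Touch (i j : D.Cell Ω) : Prop :=
  ((i.1.1 : ℤ) - (j.1.1 : ℤ)).natAbs ≤ 1 ∧ ((i.1.2 : ℤ) - (j.1.2 : ℤ)).natAbs ≤ 1

/-- The grid covers `Ω`, and each robot `p n` and each target `r m` occupies exactly one cell. -/
def IsDiscretization {N M : ℕ} (D : UniformGrid) (Ω : Set (ℝ × ℝ))
    (p : Fin N → ℝ × ℝ) (r : Fin M → ℝ × ℝ) : Prop :=
  Ω ⊆ D.region ∧
    (∀ n, ∃! i : D.Cell Ω, p n ∈ i.carrier) ∧ (∀ m, ∃! i : D.Cell Ω, r m ∈ i.carrier)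

/-- No cell contains two different points among the robots and targets. -/
def Separates {N M : ℕ} (D : UniformGrid) (Ω : Set (ℝ × ℝ))
    (p : Fin N → ℝ × ℝ) (r : Fin M → ℝ × ℝ) : Prop :=
  ∀ i : D.Cell Ω, (i.carrier ∩ (Set.range p ∪ Set.range r)).Subsingleton

/-- The matrices of transition costs: staying is free, a one-step transition between edge-sharing
unblocked cells costs at most `1`, a jump to a cell that is not a neighbour and a transition into
an obstacle cost more than `1`, possibly `∞`. Transitions between unblocked cells that share only
a corner may, or may not, be counted as one-step transitions. -/
structure IsTransitionCost (D : UniformGrid) (Ω κ : Set (ℝ × ℝ))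
    (C : Matrix (D.Cell Ω) (D.Cell Ω) ℝ≥0∞) : Prop where
  stay : ∀ i, C i i = 0
  step : ∀ i j, i.ShareEdge j → ¬ i.Blocked κ → ¬ j.Blocked κ → C i j ≤ 1
  jump : ∀ i j, ¬ i.Touch j → 1 < C i j
  obstacle : ∀ i j, i ≠ j → j.Blocked κ → 1 < C i j

open Classical in
/-- The source distribution `μ`: zero on the cells of targets, one on all other cells. -/
def source {M : ℕ} (D : UniformGrid) (Ω : Set (ℝ × ℝ)) (r : Fin M → ℝ × ℝ) (i : D.Cell Ω) : ℝ :=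
  if ∃ m, r m ∈ i.carrier then 0 else 1

open Classical in
/-- The target distribution `ν`: zero on the cells of robots, one on all other cells. -/
def sink {N : ℕ} (D : UniformGrid) (Ω : Set (ℝ × ℝ)) (p : Fin N → ℝ × ℝ) (i : D.Cell Ω) : ℝ :=
  if ∃ n, p n ∈ i.carrier then 0 else 1

/-- The marginal constraints on a transport plan `P`: the row sums are at most `μ`, the column sums
at most `ν`, and the total mass is `min ‖μ‖₁ ‖ν‖₁`; with as many robots as targets, the row and
column sums are equal to `μ` and `ν`. -/
structure MarginalConstraints {N M : ℕ} (D : UniformGrid) (Ω : Set (ℝ × ℝ))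
    (p : Fin N → ℝ × ℝ) (r : Fin M → ℝ × ℝ) (P : Matrix (D.Cell Ω) (D.Cell Ω) ℝ) : Prop where
  row_le : ∀ i, ∑ j, P i j ≤ D.source Ω r i
  col_le : ∀ j, ∑ i, P i j ≤ D.sink Ω p j
  total : ∑ i, ∑ j, P i j = min (∑ i, D.source Ω r i) (∑ i, D.sink Ω p i)
  row_eq : N = M → ∀ i, ∑ j, P i j = D.source Ω r i
  col_eq : N = M → ∀ j, ∑ i, P i j = D.sink Ω p j

/-- Practical feasibility with cost matrix `C`: there is a 0/1 transport plan of finite cost that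
meets the marginal constraints and uses only transitions of cost at most `1`. -/
def PracticallyFeasible {N M : ℕ} (D : UniformGrid) (Ω : Set (ℝ × ℝ))
    (p : Fin N → ℝ × ℝ) (r : Fin M → ℝ × ℝ) (C : Matrix (D.Cell Ω) (D.Cell Ω) ℝ≥0∞) : Prop :=
  ∃ P : Matrix (D.Cell Ω) (D.Cell Ω) ℝ,
    (∀ i j, P i j = 0 ∨ P i j = 1) ∧
    (∑ i, ∑ j, ENNReal.ofReal (P i j) * C i j) < ∞ ∧
    D.MarginalConstraints Ω p r P ∧
    ∀ i j, P i j = 1 → C i j ≤ 1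

end UniformGrid

end

/-! A 0/1 plan amounts to moving holes: cells without robots must be matched with cells without
targets, each staying put or crossing one edge between unblocked cells. Let `A` be the robot cells
and `B` the target cells, with `B` no larger than `A`; the other case follows by exchanging their
roles and transposing the plan. By Hall's theorem it suffices that every set `T` of cells off `A`
satisfies `#(T ∩ B) ≤ #(S \ B)`, where `S` is the outer neighbourhood of `T`
(`exists_injective_of_card_inter_le`).

The grid is refined twice. The first refinement separates the points and is so fine that every box
met by one of the paths is unblocked; a path then yields a chain of edge-adjacent unblocked boxes
(`reflTransGen_of_path`). The second divides each such box into a block of `L × L` cells with `L ≥ 2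
* #B`. If Hall's condition fails, `S` has fewer than `L` cells, so every block has a row and a
column free of `S`, and these link up along a chain: `S` cannot cut it (`mem_of_chain`). By
pigeonhole some `b ∈ T ∩ B` and some `a ∈ A` have blocks that avoid `S`, so `T` spreads from `b` to
`a`, although it avoids `A` (`card_inter_le_of_blocks`).

New grid lines must not hit the points. This is achieved by dividing into `1 + t` parts with `t`
divisible by suitable periods. -/

noncomputable section

/-! ### Hall's theorem -/

open Finset in
/-- Hall's theorem for a graph: if every set `T` that avoids `A` has at least as many outer
neighbours off `B` as it has elements in `B`, then the complement of `A` is injected into the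
complement of `B` along edges and loops. -/
theorem exists_injective_of_card_inter_le {V : Type*} [Fintype V] [DecidableEq V]
    (adj : V → V → Prop) [DecidableRel adj] (A B : Finset V)
    (h : ∀ T : Finset V, Disjoint A T →
      #(T ∩ B) ≤ #(({y | y ∉ T ∧ ∃ x ∈ T, adj x y} : Finset V) \ B)) :
    ∃ f : {j // j ∉ A} → V, Function.Injective f ∧
      ∀ j, f j ∉ B ∧ (f j = j ∨ adj j (f j)) := by
  obtain ⟨f, hf, hft⟩ := (Finset.all_card_le_biUnion_card_iff_exists_injective
    (fun j : {j // j ∉ A} => ({i | i ∉ B ∧ (i = j ∨ adj j i)} : Finset V))).1 (by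
      intro s
      set T : Finset V := s.map (Function.Embedding.subtype _) with hT
      have hAT : Disjoint A T := by
        rw [Finset.disjoint_right]
        intro x hx
        obtain ⟨y, -, rfl⟩ := Finset.mem_map.1 hx
        exact y.2
      have hmem : ∀ x ∈ T, ∃ y ∈ s, (y : V) = x := by
        intro x hx
        obtain ⟨y, hy, rfl⟩ := Finset.mem_map.1 hx
        exact ⟨y, hy, rfl⟩
      set S : Finset V := {y | y ∉ T ∧ ∃ x ∈ T, adj x y} with hS
      have hdisj : Disjoint (S \ B) (T \ B) := by
        rw [Finset.disjoint_left]
        intro x hx hx'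
        rw [hS, Finset.mem_sdiff, Finset.mem_filter] at hx
        exact hx.1.2.1 (Finset.mem_sdiff.1 hx').1
      -- Loops reach `T \ B` and edges reach `S \ B`; since these are disjoint, only `T ∩ B` has to
      -- be made up for by `S \ B`.
      calc #s = #T := (Finset.card_map _).symm
        _ = #(T ∩ B) + #(T \ B) := (Finset.card_inter_add_card_sdiff T B).symm
        _ ≤ #(S \ B) + #(T \ B) := Nat.add_le_add_right (h T hAT) _
        _ = #(S \ B ∪ T \ B) := (Finset.card_union_of_disjoint hdisj).symm
        _ ≤ _ := by
          refine Finset.card_le_card fun x hx => ?_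
          rw [Finset.mem_biUnion]
          rcases Finset.mem_union.1 hx with hx | hx
          · rw [Finset.mem_sdiff, hS, Finset.mem_filter] at hx
            obtain ⟨⟨-, -, z, hz, hzx⟩, hxB⟩ := hx
            obtain ⟨y, hy, rfl⟩ := hmem z hz
            exact ⟨y, hy, by simp [hxB, hzx]⟩
          · rw [Finset.mem_sdiff] at hx
            obtain ⟨y, hy, rfl⟩ := hmem x hx.1
            exact ⟨y, hy, by simp [hx.2]⟩)
  exact ⟨f, hf, fun j => by simpa using hft j⟩

/-! ### Small sets of squares do not separate chains of blocks -/

/-- Two squares of the integer lattice that share an edge. -/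
def EdgeAdj (x y : ℕ × ℕ) : Prop :=
  (x.1 = y.1 ∧ (x.2 + 1 = y.2 ∨ y.2 + 1 = x.2)) ∨ (x.2 = y.2 ∧ (x.1 + 1 = y.1 ∨ y.1 + 1 = x.1))

theorem EdgeAdj.symm {x y : ℕ × ℕ} (h : EdgeAdj x y) : EdgeAdj y x := by
  rw [EdgeAdj] at *
  omega

/-- The block of side `L` that contains a square of the integer lattice. -/
def blockOf (L : ℕ) (x : ℕ × ℕ) : ℕ × ℕ := (x.1 / L, x.2 / L)

theorem Nat.induction_uIcc {P : ℕ → Prop} {a b : ℕ}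
    (h : ∀ i ∈ Set.uIcc a b, ∀ j ∈ Set.uIcc a b, (i + 1 = j ∨ j + 1 = i) → P i → P j)
    (ha : P a) : P b := by
  rcases le_total a b with hab | hab
  · rw [Set.uIcc_of_le hab] at h
    have key : ∀ d, a + d ≤ b → P (a + d) := by
      intro d
      induction d with
      | zero => intro _; exact ha
      | succ d ih =>
        intro hd
        exact h (a + d) ⟨by omega, by omega⟩ _ ⟨by omega, by omega⟩ (by omega) (ih (by omega))
    have := key (b - a) (by omega)
    rwa [show a + (b - a) = b by omega] at this
  · rw [Set.uIcc_of_ge hab] at h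
    have key : ∀ d, d ≤ a - b → P (a - d) := by
      intro d
      induction d with
      | zero => intro _; exact ha
      | succ d ih =>
        intro hd
        exact h (a - d) ⟨by omega, by omega⟩ _ ⟨by omega, by omega⟩ (by omega) (ih (by omega))
    have := key (a - b) le_rfl
    rwa [show a - (a - b) = b by omega] at this

section Blocks

variable {L : ℕ} {F : Set (ℕ × ℕ)} {S T : Finset (ℕ × ℕ)}

/-- By `hstep`, `T` can be left inside `F` only through `S`, so membership propagates along an
L-shaped walk that avoids `S`, with its corner at `(X', Y)`. -/
theorem mem_of_bend
    (hstep : ∀ x y, blockOf L x ∈ F → blockOf L y ∈ F → EdgeAdj x y → x ∈ T → y ∉ T → y ∈ S)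
    {X X' Y Y' : ℕ}
    (hrow : ∀ i ∈ Set.uIcc X X', blockOf L (i, Y) ∈ F ∧ (i, Y) ∉ S)
    (hcol : ∀ j ∈ Set.uIcc Y Y', blockOf L (X', j) ∈ F ∧ (X', j) ∉ S)
    (h : (X, Y) ∈ T) : (X', Y') ∈ T := by
  have h1 : (X', Y) ∈ T := by
    refine Nat.induction_uIcc (P := fun i => (i, Y) ∈ T) (fun i hi j hj hij hT => ?_) h
    by_contra hjT
    exact (hrow j hj).2 (hstep _ _ (hrow i hi).1 (hrow j hj).1 (Or.inr ⟨rfl, hij⟩) hT hjT)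
  refine Nat.induction_uIcc (P := fun j => (X', j) ∈ T) (fun i hi j hj hij hT => ?_) h1
  by_contra hjT
  exact (hcol j hj).2 (hstep _ _ (hcol i hi).1 (hcol j hj).1 (Or.inl ⟨rfl, hij⟩) hT hjT)

theorem div_mem_uIcc {a b i : ℕ} (hi : i ∈ Set.uIcc a b) : i / L ∈ Set.uIcc (a / L) (b / L) := by
  rw [Set.mem_uIcc] at *
  rcases hi with hi | hi
  · exact Or.inl ⟨Nat.div_le_div_right hi.1, Nat.div_le_div_right hi.2⟩
  · exact Or.inr ⟨Nat.div_le_div_right hi.1, Nat.div_le_div_right hi.2⟩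

/-- A square whose row avoids `S` and a square of an edge-adjacent block whose column avoids `S`
are on the same side of `S`. -/
theorem mem_of_blocks_adj
    (hstep : ∀ x y, blockOf L x ∈ F → blockOf L y ∈ F → EdgeAdj x y → x ∈ T → y ∉ T → y ∈ S)
    {x y : ℕ × ℕ} (hx : blockOf L x ∈ F) (hy : blockOf L y ∈ F)
    (hxy : EdgeAdj (blockOf L x) (blockOf L y))
    (hx2 : ∀ s ∈ S, s.2 ≠ x.2) (hy1 : ∀ s ∈ S, s.1 ≠ y.1) (h : x ∈ T) : y ∈ T := by
  obtain ⟨X, Y⟩ := x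
  obtain ⟨X', Y'⟩ := y
  simp only [blockOf, EdgeAdj] at hx hy hxy
  refine mem_of_bend hstep (fun i hi => ⟨?_, fun hs => hx2 _ hs rfl⟩)
    (fun j hj => ⟨?_, fun hs => hy1 _ hs rfl⟩) h
  · have := div_mem_uIcc (L := L) hi
    rw [Set.mem_uIcc] at this
    simp only [blockOf]
    -- The bend stays in the two blocks: if they are in one block column, only its vertical leg
    -- changes block, otherwise only its horizontal leg does.
    rcases hxy with ⟨h1, -⟩ | ⟨h2, h1⟩
    · rwa [show i / L = X / L by omega]
    · rcases (show i / L = X / L ∨ i / L = X' / L by omega) with h | h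
      · rwa [h]
      · rwa [h, h2]
  · have := div_mem_uIcc (L := L) hj
    rw [Set.mem_uIcc] at this
    simp only [blockOf]
    rcases hxy with ⟨h1, h2⟩ | ⟨h2, h1⟩
    · rcases (show j / L = Y / L ∨ j / L = Y' / L by omega) with h | h
      · rwa [h, ← h1]
      · rwa [h]
    · rwa [show j / L = Y' / L by omega]

theorem mem_of_block_eq
    (hstep : ∀ x y, blockOf L x ∈ F → blockOf L y ∈ F → EdgeAdj x y → x ∈ T → y ∉ T → y ∈ S)
    {x y : ℕ × ℕ} (hx : blockOf L x ∈ F) (hxy : blockOf L x = blockOf L y)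
    (hS : ∀ s ∈ S, blockOf L s ≠ blockOf L x) (h : x ∈ T) : y ∈ T := by
  obtain ⟨X, Y⟩ := x
  obtain ⟨X', Y'⟩ := y
  have hxy' := hxy
  simp only [blockOf, Prod.mk.injEq] at hxy'
  have key : ∀ z, blockOf L z = blockOf L (X, Y) → blockOf L z ∈ F ∧ z ∉ S :=
    fun z hz => ⟨hz ▸ hx, fun hs => hS z hs hz⟩
  refine mem_of_bend hstep (fun i hi => key _ ?_) (fun j hj => key _ ?_) h
  · have := div_mem_uIcc (L := L) hi
    rw [Set.mem_uIcc] at this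
    simp only [blockOf, Prod.mk.injEq, and_true]
    omega
  · have := div_mem_uIcc (L := L) hj
    rw [Set.mem_uIcc] at this
    simp only [blockOf, Prod.mk.injEq]
    omega

theorem exists_div_eq_not_mem {s : Finset ℕ} (hs : s.card < L) (a : ℕ) :
    ∃ i, i / L = a ∧ i ∉ s := by
  by_contra! hcon
  have hsub : (Finset.range L).image (fun d => a * L + d) ⊆ s := by
    intro i hi
    obtain ⟨d, hd, rfl⟩ := Finset.mem_image.1 hi
    have hd := Finset.mem_range.1 hd
    refine hcon _ ?_
    rw [Nat.add_comm, Nat.add_mul_div_right _ _ (by omega), Nat.div_eq_of_lt hd, Nat.zero_add]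
  have := Finset.card_le_card hsub
  rw [Finset.card_image_of_injective _ (fun x y h => by simpa using h), Finset.card_range] at this
  omega

/-- Fewer than `L` squares cannot occupy all `L` columns, nor all `L` rows, of a block. -/
theorem exists_mem_block (hS : S.card < L) (q : ℕ × ℕ) :
    ∃ x, blockOf L x = q ∧ (∀ s ∈ S, s.1 ≠ x.1) ∧ ∀ s ∈ S, s.2 ≠ x.2 := by
  obtain ⟨i, hi, hi'⟩ := exists_div_eq_not_mem (Finset.card_image_le.trans_lt hS :
    (S.image Prod.fst).card < L) q.1
  obtain ⟨j, hj, hj'⟩ := exists_div_eq_not_mem (Finset.card_image_le.trans_lt hS :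
    (S.image Prod.snd).card < L) q.2
  exact ⟨(i, j), Prod.ext hi hj, fun s hs h => hi' (Finset.mem_image.2 ⟨s, hs, h⟩),
    fun s hs h => hj' (Finset.mem_image.2 ⟨s, hs, h⟩)⟩

/-- A set of fewer than `L` squares does not separate blocks of side `L` that are joined by a
chain of edge-adjacent blocks. -/
theorem mem_of_chain (hL : S.card < L)
    (hstep : ∀ x y, blockOf L x ∈ F → blockOf L y ∈ F → EdgeAdj x y → x ∈ T → y ∉ T → y ∈ S)
    {q q' : ℕ × ℕ}
    (hq : Relation.ReflTransGen (fun q q' => q ∈ F ∧ q' ∈ F ∧ EdgeAdj q q') q q')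
    (h : ∃ x, blockOf L x = q ∧ (∀ s ∈ S, s.2 ≠ x.2) ∧ x ∈ T) :
    ∃ x, blockOf L x = q' ∧ (∀ s ∈ S, s.2 ≠ x.2) ∧ x ∈ T := by
  induction hq with
  | refl => exact h
  | @tail _ c _ hbc ih =>
    obtain ⟨x, rfl, hx2, hxT⟩ := ih
    -- The free column of `y` ends the bend from `x`; its free row starts the bend into the next
    -- block.
    obtain ⟨y, rfl, hy1, hy2⟩ := exists_mem_block hL c
    exact ⟨y, rfl, hy2, mem_of_blocks_adj hstep hbc.1 hbc.2.1 hbc.2.2 hx2 hy1 hxT⟩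

theorem exists_block_disjoint {A R : Finset (ℕ × ℕ)}
    (hA : ∀ x ∈ A, ∀ y ∈ A, blockOf L x = blockOf L y → x = y) (h : R.card < A.card) :
    ∃ a ∈ A, ∀ s ∈ R, blockOf L s ≠ blockOf L a := by
  by_contra! hcon
  choose! g hg using hcon
  refine absurd (Finset.card_le_card_of_injOn g (fun a ha => (hg a ha).1) ?_) (not_le.2 h)
  intro x hx y hy hxy
  exact hA x hx y hy (by rw [← (hg x hx).2, ← (hg y hy).2, hxy])

-- This is Hall's condition. A violation bounds `#S` by `L` and leaves too few squares in `S \ B` to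
-- hit the blocks of all of `T ∩ B`, or of all of `A`.
open Finset in
theorem card_inter_le_of_blocks {A B : Finset (ℕ × ℕ)}
    (hstep : ∀ x y, blockOf L x ∈ F → blockOf L y ∈ F → EdgeAdj x y → x ∈ T → y ∉ T → y ∈ S)
    (hST : Disjoint S T) (hAT : Disjoint A T) (hAB : Disjoint A B)
    (hinj : ∀ x ∈ A ∪ B, ∀ y ∈ A ∪ B, blockOf L x = blockOf L y → x = y)
    (hF : ∀ x ∈ A ∪ B, blockOf L x ∈ F)
    (hchain : ∀ a ∈ A, ∀ b ∈ B, Relation.ReflTransGen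
      (fun q q' => q ∈ F ∧ q' ∈ F ∧ EdgeAdj q q') (blockOf L b) (blockOf L a))
    (hcard : #B ≤ #A) (hL : 2 * #B ≤ L) : #(T ∩ B) ≤ #(S \ B) := by
  by_contra! hlt
  have hTB : #(T ∩ B) ≤ #B := card_le_card inter_subset_right
  have hS : #S < L := by
    have h1 := card_inter_add_card_sdiff S B
    have h2 : #(S ∩ B) ≤ #B := card_le_card inter_subset_right
    omega
  have hA' : ∀ x ∈ A, x ∈ A ∪ B := fun x hx => mem_union_left _ hx
  have hB' : ∀ x ∈ B, x ∈ A ∪ B := fun x hx => mem_union_right _ hx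
  obtain ⟨b, hb, hbS⟩ := exists_block_disjoint (L := L) (A := T ∩ B) (R := S \ B)
    (fun x hx y hy => hinj x (hB' x (mem_inter.1 hx).2) y (hB' y (mem_inter.1 hy).2)) hlt
  obtain ⟨a, ha, haS⟩ := exists_block_disjoint (L := L) (A := A) (R := S \ B)
    (fun x hx y hy => hinj x (hA' x hx) y (hA' y hy)) (by omega)
  obtain ⟨hbT, hb⟩ := mem_inter.1 hb
  have hbS' : ∀ s ∈ S, blockOf L s ≠ blockOf L b := by
    intro s hs h
    by_cases hsB : s ∈ B
    -- Different elements of `B` have different blocks, so `s` would be `b`, which lies in `T` and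
    -- not in `S`.
    · obtain rfl := hinj s (hB' s hsB) b (hB' b hb) h
      exact disjoint_left.1 hST hs hbT
    · exact hbS s (mem_sdiff.2 ⟨hs, hsB⟩) h
  have haS' : ∀ s ∈ S, blockOf L s ≠ blockOf L a := by
    intro s hs h
    by_cases hsB : s ∈ B
    · obtain rfl := hinj s (hB' s hsB) a (hA' a ha) h
      exact disjoint_left.1 hAB ha hsB
    · exact haS s (mem_sdiff.2 ⟨hs, hsB⟩) h
  obtain ⟨x, hxb, -, hx2⟩ := exists_mem_block hS (blockOf L b)
  obtain ⟨y, hya, -, hyT⟩ := mem_of_chain hS hstep (hchain a ha b hb)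
    ⟨x, hxb, hx2, mem_of_block_eq hstep (hF b (hB' b hb)) hxb.symm hbS' hbT⟩
  refine disjoint_left.1 hAT ha (mem_of_block_eq hstep (x := y) ?_ hya ?_ hyT)
  · rw [hya]; exact hF a (hA' a ha)
  · rw [hya]; exact haS'

end Blocks

/-! ### One-dimensional grids -/

/-- The `a`-th of the intervals of length `w` that follow each other from `o` on. -/
def gridInterval (o w : ℝ) (a : ℕ) : Set ℝ := Set.Icc (o + a * w) (o + (a + 1) * w)

theorem exists_mem_gridInterval_iff {o w s : ℝ} (hw : 0 < w) {n : ℕ} :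
    (∃ a < n, s ∈ gridInterval o w a) ↔ 0 < n ∧ s ∈ Set.Icc o (o + n * w) := by
  constructor
  · rintro ⟨a, han, h1, h2⟩
    have han' : (a : ℝ) + 1 ≤ n := by exact_mod_cast han
    have h0 : 0 ≤ (a : ℝ) * w := by positivity
    have := mul_le_mul_of_nonneg_right han' hw.le
    exact ⟨by omega, by linarith, by linarith⟩
  · rintro ⟨hn, h1, h2⟩
    -- The right end belongs to interval `n - 1`; rounding down would give `n`.
    rcases h2.eq_or_lt with h2 | h2
    · have hcast : ((n - 1 : ℕ) : ℝ) = n - 1 := by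
        rw [Nat.cast_sub hn]; simp
      refine ⟨n - 1, by omega, ?_, ?_⟩
      · rw [hcast, h2]; nlinarith
      · rw [hcast, h2]; simp
    · have hu0 : 0 ≤ (s - o) / w := div_nonneg (by linarith) hw.le
      have hun : (s - o) / w < n := by rw [div_lt_iff₀ hw]; linarith
      refine ⟨⌊(s - o) / w⌋₊, (Nat.floor_lt hu0).2 hun, ?_, ?_⟩
      · have := Nat.floor_le hu0
        rw [le_div_iff₀ hw] at this
        linarith
      · have := (Nat.lt_floor_add_one ((s - o) / w)).le
        rw [div_le_iff₀ hw] at this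
        linarith

/-- Closed intervals of the grid overlap only at interior grid points; each outer end belongs to
just one interval. -/
theorem existsUnique_mem_gridInterval_iff {o w s : ℝ} (hw : 0 < w) {n : ℕ} :
    (∃! a, a < n ∧ s ∈ gridInterval o w a) ↔
      0 < n ∧ s ∈ Set.Icc o (o + n * w) ∧ ∀ z : ℕ, 0 < z → z < n → s ≠ o + z * w := by
  constructor
  · rintro ⟨a, ha, hu⟩
    obtain ⟨h1, h2⟩ := (exists_mem_gridInterval_iff hw).1 ⟨a, ha⟩
    refine ⟨h1, h2, fun z hz hzn hs => ?_⟩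
    have hcast : ((z - 1 : ℕ) : ℝ) = z - 1 := by
      rw [Nat.cast_sub hz]; simp
    have e1 := hu z ⟨hzn, by rw [hs], by rw [hs]; nlinarith⟩
    have e2 := hu (z - 1) ⟨by omega, by rw [hs, hcast]; nlinarith, by rw [hs, hcast]; simp⟩
    omega
  · rintro ⟨h1, h2, h3⟩
    obtain ⟨a, ha⟩ := (exists_mem_gridInterval_iff hw).2 ⟨h1, h2⟩
    have key : ∀ a b : ℕ, b < n → s ∈ gridInterval o w a → s ∈ gridInterval o w b → ¬ a < b := by
      intro a b hbn ha hb hab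
      have hab' : (a : ℝ) + 1 ≤ b := by exact_mod_cast hab
      have := mul_le_mul_of_nonneg_right hab' hw.le
      exact h3 b (by omega) hbn (le_antisymm (by linarith [ha.2]) hb.1)
    refine ⟨a, ha, fun b hb => ?_⟩
    have k1 := key a b hb.1 ha.2 hb.2
    have k2 := key b a ha.1 hb.2 ha.2
    omega

/-- If `Q * u = y` is an integer and `t = Q * t'`, then `(1 + t) * u` differs from `u` by the
integer `t' * y`. If no positive multiple of `u` is an integer, there is nothing to check. -/
theorem exists_forall_one_add_mul_eq_intCast (u : ℝ) :
    ∃ Q : ℕ, 0 < Q ∧ ∀ t : ℕ, Q ∣ t → ∀ z : ℤ, ((1 + t : ℕ) : ℝ) * u = z → ∃ z' : ℤ, u = z' := by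
  by_cases h : ∃ Q : ℕ, 0 < Q ∧ ∃ z : ℤ, (Q : ℝ) * u = z
  · obtain ⟨Q, hQ, y, hy⟩ := h
    refine ⟨Q, hQ, ?_⟩
    rintro _ ⟨t, rfl⟩ z hz
    refine ⟨z - t * y, ?_⟩
    push_cast at hz ⊢
    rw [← hz, ← hy]
    ring
  · exact ⟨1, one_pos, fun t _ z hz => absurd ⟨1 + t, by omega, z, hz⟩ h⟩

/-- A point in the interior of a cell of a one-dimensional grid is in the interior of a cell of
the grids that divide each cell into `k` cells, for all `k` in some residue class. -/
theorem exists_existsUnique_gridInterval_div {o w s : ℝ} (hw : 0 < w) {n : ℕ}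
    (h : ∃! a, a < n ∧ s ∈ gridInterval o w a) :
    ∃ Q : ℕ, 0 < Q ∧ ∀ t : ℕ, Q ∣ t →
      ∃! a, a < n * (1 + t) ∧ s ∈ gridInterval o (w / (1 + t : ℕ)) a := by
  obtain ⟨Q, hQ, hQu⟩ := exists_forall_one_add_mul_eq_intCast ((s - o) / w)
  refine ⟨Q, hQ, fun t ht => ?_⟩
  have hk : (0 : ℝ) < (1 + t : ℕ) := by positivity
  rw [existsUnique_mem_gridInterval_iff hw] at h
  obtain ⟨h1, h2, h3⟩ := h
  rw [existsUnique_mem_gridInterval_iff (div_pos hw hk)]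
  refine ⟨by positivity, ?_, fun z hz hzn hs => ?_⟩
  · convert h2 using 3
    rw [Nat.cast_mul]
    field_simp
  · have hz' : ((1 + t : ℕ) : ℝ) * ((s - o) / w) = z := by
      rw [hs]; field_simp; ring
    obtain ⟨y, hy⟩ := hQu t ht z (by exact_mod_cast hz')
    rw [hy] at hz'
    have hz2 : ((1 + t : ℕ) : ℤ) * y = z := by exact_mod_cast hz'
    have hy0 : 0 < y := by
      by_contra hcon
      have : ((1 + t : ℕ) : ℤ) * y ≤ 0 := mul_nonpos_of_nonneg_of_nonpos (by positivity) (by omega)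
      omega
    lift y to ℕ using hy0.le
    have hyn : y < n := by
      by_contra! hcon
      have h4 := Nat.mul_le_mul_left (1 + t) hcon
      have h5 : (1 + t) * y = z := by exact_mod_cast hz2
      rw [h5, Nat.mul_comm] at h4
      omega
    refine h3 y (by exact_mod_cast hy0) hyn ?_
    rw [div_eq_iff hw.ne'] at hy
    push_cast at hy
    linarith

theorem gridInterval_div_subset {o w : ℝ} (hw : 0 < w) {L : ℕ} (hL : 0 < L) (a : ℕ) :
    gridInterval o (w / L) a ⊆ gridInterval o w (a / L) := by
  have hL' : (0 : ℝ) < L := by exact_mod_cast hL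
  have h1 : ((a / L : ℕ) : ℝ) * L ≤ a := by exact_mod_cast Nat.div_mul_le_self a L
  have h2 : (a : ℝ) + 1 ≤ ((a / L : ℕ) + 1) * L := by
    have : a < (a / L + 1) * L := by
      rw [Nat.mul_comm]; exact Nat.lt_mul_div_succ a hL
    exact_mod_cast this
  have hw' : 0 < w / L := div_pos hw hL'
  have e : w = L * (w / L) := by field_simp
  refine Set.Icc_subset_Icc ?_ ?_
  · have := mul_le_mul_of_nonneg_right h1 hw'.le
    rw [mul_assoc, ← e] at this
    linarith
  · have := mul_le_mul_of_nonneg_right h2 hw'.le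
    rw [mul_assoc, ← e] at this
    linarith

theorem abs_sub_le_of_mem_gridInterval {o w s t : ℝ} {a : ℕ} (hs : s ∈ gridInterval o w a)
    (ht : t ∈ gridInterval o w a) : |s - t| ≤ w := by
  rw [abs_le]
  constructor <;> linarith [hs.1, hs.2, ht.1, ht.2]

/-! ### Planar grids and their subdivisions -/

namespace UniformGrid

/-- The rectangle in column `q.1` and row `q.2` of the grid, extended to all indices. -/
def square (D : UniformGrid) (q : ℕ × ℕ) : Set (ℝ × ℝ) :=
  gridInterval D.origin.1 D.width q.1 ×ˢ gridInterval D.origin.2 D.height q.2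

/-- The indices of the boxes of the grid that lie in `U`. -/
def freeSquares (D : UniformGrid) (U : Set (ℝ × ℝ)) : Set (ℕ × ℕ) :=
  {q | q.1 < D.cols ∧ q.2 < D.rows ∧ D.square q ⊆ U}

variable {D : UniformGrid} {Ω : Set (ℝ × ℝ)}

/-- The column and the row of a cell. -/
def Cell.index (i : D.Cell Ω) : ℕ × ℕ := (i.1.1, i.1.2)

theorem Cell.index_injective : Function.Injective (Cell.index : D.Cell Ω → ℕ × ℕ) := by
  intro i j h
  rw [Cell.index, Cell.index, Prod.mk.injEq] at h
  exact Subtype.ext (Prod.ext (Fin.ext h.1) (Fin.ext h.2))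

theorem Cell.carrier_eq (i : D.Cell Ω) : i.carrier = D.square i.index := rfl

theorem Cell.shareEdge_iff {i j : D.Cell Ω} : i.ShareEdge j ↔ EdgeAdj i.index j.index := by
  simp only [Cell.ShareEdge, EdgeAdj, Cell.index]
  omega

theorem mem_region_iff {x : ℝ × ℝ} :
    x ∈ D.region ↔ ∃ q : ℕ × ℕ, q.1 < D.cols ∧ q.2 < D.rows ∧ x ∈ D.square q := by
  constructor
  · intro h
    obtain ⟨c, hc⟩ := Set.mem_iUnion.1 h
    exact ⟨(c.1, c.2), c.1.2, c.2.2, hc⟩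
  · rintro ⟨q, h1, h2, hq⟩
    exact Set.mem_iUnion.2 ⟨(⟨q.1, h1⟩, ⟨q.2, h2⟩), hq⟩

theorem mem_region_iff_mem_Icc {x : ℝ × ℝ} :
    x ∈ D.region ↔ (0 < D.cols ∧ x.1 ∈ Set.Icc D.origin.1 (D.origin.1 + D.cols * D.width)) ∧
      (0 < D.rows ∧ x.2 ∈ Set.Icc D.origin.2 (D.origin.2 + D.rows * D.height)) := by
  rw [mem_region_iff, ← exists_mem_gridInterval_iff D.width_pos,
    ← exists_mem_gridInterval_iff D.height_pos]
  constructor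
  · rintro ⟨q, h1, h2, hq⟩
    exact ⟨⟨q.1, h1, hq.1⟩, ⟨q.2, h2, hq.2⟩⟩
  · rintro ⟨⟨a, h1, ha⟩, ⟨b, h2, hb⟩⟩
    exact ⟨(a, b), h1, h2, ha, hb⟩

theorem region_subdivide {k : ℕ} (hk : 0 < k) : (D.subdivide k hk).region = D.region := by
  have hk' : (k : ℝ) ≠ 0 := by positivity
  have e : ∀ (n : ℕ) (w : ℝ), ((n * k : ℕ) : ℝ) * (w / k) = n * w := by
    intro n w; rw [Nat.cast_mul]; field_simp
  ext x
  rw [mem_region_iff_mem_Icc, mem_region_iff_mem_Icc]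
  simp only [subdivide, e, Nat.mul_pos_iff_of_pos_right hk]

theorem subdivide_subdivide {k l : ℕ} (hk : 0 < k) (hl : 0 < l) (hkl : 0 < k * l) :
    (D.subdivide k hk).subdivide l hl = D.subdivide (k * l) hkl := by
  simp only [subdivide, Nat.mul_assoc, div_div, Nat.cast_mul]

/-- The cell with a given index. -/
def Cell.mk {q : ℕ × ℕ} (h1 : q.1 < D.cols) (h2 : q.2 < D.rows)
    (h : (D.square q ∩ Ω).Nonempty) : D.Cell Ω :=
  ⟨(⟨q.1, h1⟩, ⟨q.2, h2⟩), h⟩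

theorem existsUnique_cell_iff {x : ℝ × ℝ} (hx : x ∈ Ω) :
    (∃! i : D.Cell Ω, x ∈ i.carrier) ↔
      (∃! a, a < D.cols ∧ x.1 ∈ gridInterval D.origin.1 D.width a) ∧
        (∃! b, b < D.rows ∧ x.2 ∈ gridInterval D.origin.2 D.height b) := by
  constructor
  · rintro ⟨i, hi, hu⟩
    have key : ∀ q : ℕ × ℕ, q.1 < D.cols → q.2 < D.rows → x ∈ D.square q → q = i.index :=
      fun q h1 h2 hq => congrArg Cell.index (hu (Cell.mk h1 h2 ⟨x, hq, hx⟩) hq)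
    refine ⟨⟨i.index.1, ⟨i.1.1.2, hi.1⟩, fun a ha => ?_⟩, ⟨i.index.2, ⟨i.1.2.2, hi.2⟩,
      fun b hb => ?_⟩⟩
    · exact congrArg Prod.fst (key (a, i.index.2) ha.1 i.1.2.2 ⟨ha.2, hi.2⟩)
    · exact congrArg Prod.snd (key (i.index.1, b) i.1.1.2 hb.1 ⟨hi.1, hb.2⟩)
  · rintro ⟨⟨a, ⟨ha, hxa⟩, hua⟩, ⟨b, ⟨hb, hxb⟩, hub⟩⟩
    have hab : x ∈ D.square (a, b) := ⟨hxa, hxb⟩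
    refine ⟨Cell.mk (q := (a, b)) ha hb ⟨x, hab, hx⟩, hab, fun i hi => Cell.index_injective ?_⟩
    exact Prod.ext (hua _ ⟨i.1.1.2, hi.1⟩) (hub _ ⟨i.1.2.2, hi.2⟩)

theorem exists_existsUnique_cell_subdivide {x : ℝ × ℝ} (hx : x ∈ Ω)
    (h : ∃! i : D.Cell Ω, x ∈ i.carrier) :
    ∃ Q : ℕ, 0 < Q ∧ ∀ t : ℕ, Q ∣ t → ∀ ht : 0 < 1 + t,
      ∃! i : (D.subdivide (1 + t) ht).Cell Ω, x ∈ i.carrier := by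
  rw [existsUnique_cell_iff hx] at h
  obtain ⟨Q, hQ, h1⟩ := exists_existsUnique_gridInterval_div D.width_pos h.1
  obtain ⟨Q', hQ', h2⟩ := exists_existsUnique_gridInterval_div D.height_pos h.2
  refine ⟨Q * Q', Nat.mul_pos hQ hQ', fun t ht ht' => ?_⟩
  rw [existsUnique_cell_iff hx]
  exact ⟨h1 t ((Dvd.intro _ rfl).trans ht), h2 t ((Dvd.intro_left _ rfl).trans ht)⟩

/-- Arbitrarily fine subdivisions of a discretization are discretizations. -/
theorem IsDiscretization.exists_subdivide {N M : ℕ} {p : Fin N → ℝ × ℝ} {r : Fin M → ℝ × ℝ}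
    (hp : ∀ n, p n ∈ Ω) (hr : ∀ m, r m ∈ Ω) (h : D.IsDiscretization Ω p r) (l : ℕ) :
    ∃ (k : ℕ) (hk : 0 < k), l < k ∧ (D.subdivide k hk).IsDiscretization Ω p r := by
  obtain ⟨hΩ, h1, h2⟩ := h
  choose Q hQ hQ1 using fun n => exists_existsUnique_cell_subdivide (hp n) (h1 n)
  choose Q' hQ' hQ2 using fun m => exists_existsUnique_cell_subdivide (hr m) (h2 m)
  -- A common multiple of all periods; the factor `l` makes the subdivision as fine as required.
  set t := l * ((∏ n, Q n) * ∏ m, Q' m) with ht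
  have hpos : 0 < (∏ n, Q n) * ∏ m, Q' m :=
    Nat.mul_pos (Finset.prod_pos fun n _ => hQ n) (Finset.prod_pos fun m _ => hQ' m)
  have hlt : l ≤ t := Nat.le_mul_of_pos_right l hpos
  refine ⟨1 + t, by omega, by omega, by rwa [region_subdivide], fun n => hQ1 n t ?_ _,
    fun m => hQ2 m t ?_ _⟩
  · exact (Finset.dvd_prod_of_mem Q (Finset.mem_univ n)).trans
      ((Dvd.intro _ rfl).trans (Dvd.intro_left _ rfl))
  · exact (Finset.dvd_prod_of_mem Q' (Finset.mem_univ m)).trans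
      ((Dvd.intro_left _ rfl).trans (Dvd.intro_left _ rfl))

theorem square_subdivide_subset {L : ℕ} (hL : 0 < L) (x : ℕ × ℕ) :
    (D.subdivide L hL).square x ⊆ D.square (blockOf L x) :=
  Set.prod_mono (gridInterval_div_subset D.width_pos hL x.1)
    (gridInterval_div_subset D.height_pos hL x.2)

theorem mem_freeSquares_subdivide {U : Set (ℝ × ℝ)} {L : ℕ} (hL : 0 < L) {x : ℕ × ℕ}
    (h : blockOf L x ∈ D.freeSquares U) : x ∈ (D.subdivide L hL).freeSquares U :=
  ⟨(Nat.div_lt_iff_lt_mul hL).1 h.1, (Nat.div_lt_iff_lt_mul hL).1 h.2.1,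
    (square_subdivide_subset hL x).trans h.2.2⟩

theorem dist_le_of_mem_square {q : ℕ × ℕ} {x y : ℝ × ℝ} (hx : x ∈ D.square q)
    (hy : y ∈ D.square q) : dist x y ≤ max D.width D.height :=
  max_le_max (abs_sub_le_of_mem_gridInterval hx.1 hy.1) (abs_sub_le_of_mem_gridInterval hx.2 hy.2)

theorem isClosed_square (q : ℕ × ℕ) : IsClosed (D.square q) := isClosed_Icc.prod isClosed_Icc

theorem square_subset_region {q : ℕ × ℕ} (h1 : q.1 < D.cols) (h2 : q.2 < D.rows) :
    D.square q ⊆ D.region := fun _ hx => mem_region_iff.2 ⟨q, h1, h2, hx⟩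

theorem finite_squares (D : UniformGrid) : {q : ℕ × ℕ | q.1 < D.cols ∧ q.2 < D.rows}.Finite :=
  ((Set.finite_Iio D.cols).prod (Set.finite_Iio D.rows)).subset fun _ hq => hq

/-! ### From paths to chains of boxes -/

/-- If all boxes that meet a path lie in `U`, then the boxes at its ends are joined by a chain of
edge-adjacent boxes that lie in `U`. -/
theorem reflTransGen_of_path {U : Set (ℝ × ℝ)} {x y : ℝ × ℝ} (γ : Path x y)
    (hγ : ∀ t, γ t ∈ D.region)
    (hU : ∀ t q, q.1 < D.cols → q.2 < D.rows → γ t ∈ D.square q → D.square q ⊆ U)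
    {a b : ℕ × ℕ} (ha : a.1 < D.cols ∧ a.2 < D.rows) (hxa : x ∈ D.square a)
    (hb : b.1 < D.cols ∧ b.2 < D.rows) (hyb : y ∈ D.square b) :
    Relation.ReflTransGen (fun q q' => q ∈ D.freeSquares U ∧ q' ∈ D.freeSquares U ∧ EdgeAdj q q')
      a b := by
  set R := fun q q' => q ∈ D.freeSquares U ∧ q' ∈ D.freeSquares U ∧ EdgeAdj q q' with hR
  have hmem : ∀ t (q : ℕ × ℕ), q.1 < D.cols ∧ q.2 < D.rows → γ t ∈ D.square q →
      q ∈ D.freeSquares U := fun t q hq h => ⟨hq.1, hq.2, hU t q hq.1 hq.2 h⟩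
  have hadj : ∀ t (q q' : ℕ × ℕ), q.1 < D.cols ∧ q.2 < D.rows → q'.1 < D.cols ∧ q'.2 < D.rows →
      γ t ∈ D.square q → γ t ∈ D.square q' → Relation.ReflTransGen R q q' := by
    intro t q q' hq hq' h h'
    have key : ∀ {o w s : ℝ} {a b : ℕ}, 0 < w → s ∈ gridInterval o w a → s ∈ gridInterval o w b →
        a ≤ b + 1 := by
      intro o w s a b hw hsa hsb
      have : (a : ℝ) * w ≤ (b + 1) * w := by linarith [hsa.1, hsb.2]
      have := le_of_mul_le_mul_right this hw
      exact_mod_cast this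
    have k1 := key D.width_pos h.1 h'.1
    have k2 := key D.width_pos h'.1 h.1
    have k3 := key D.height_pos h.2 h'.2
    have k4 := key D.height_pos h'.2 h.2
    -- If the two boxes share only a corner, this third box also contains the point of the path, so
    -- it lies in `U` and links them by edges.
    have hm : γ t ∈ D.square (q.1, q'.2) := ⟨h.1, h'.2⟩
    have fq := hmem t q hq h
    have fq' := hmem t q' hq' h'
    have fm := hmem t (q.1, q'.2) ⟨hq.1, hq'.2⟩ hm
    have s1 : Relation.ReflTransGen R q (q.1, q'.2) := by
      by_cases e : q.2 = q'.2
      · rw [← e]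
      · exact .single ⟨fq, fm, Or.inl ⟨rfl, by simp only; omega⟩⟩
    have s2 : Relation.ReflTransGen R (q.1, q'.2) q' := by
      by_cases e : q.1 = q'.1
      · rw [e]
      · exact .single ⟨fm, fq', Or.inr ⟨rfl, by simp only; omega⟩⟩
    exact s1.trans s2
  -- The times spent in reachable and in unreachable boxes form two closed sets that partition the
  -- unit interval, so connectedness makes all times reachable.
  set Z : Set (ℕ × ℕ) := {q | (q.1 < D.cols ∧ q.2 < D.rows) ∧ Relation.ReflTransGen R a q} with hZ
  set Z' : Set (ℕ × ℕ) := {q | (q.1 < D.cols ∧ q.2 < D.rows) ∧ ¬ Relation.ReflTransGen R a q}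
    with hZ'
  have hclosed : ∀ s : Set (ℕ × ℕ), s ⊆ {q : ℕ × ℕ | q.1 < D.cols ∧ q.2 < D.rows} →
      IsClosed (γ ⁻¹' ⋃ q ∈ s, D.square q) := fun s hs =>
    IsClosed.preimage γ.continuous
      ((D.finite_squares.subset hs).isClosed_biUnion fun q _ => isClosed_square q)
  have hcompl : (γ ⁻¹' ⋃ q ∈ Z, D.square q)ᶜ = γ ⁻¹' ⋃ q ∈ Z', D.square q := by
    ext t
    simp only [Set.mem_compl_iff, Set.mem_preimage, Set.mem_iUnion, exists_prop]
    constructor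
    · intro h
      obtain ⟨q, h1, h2, hq⟩ := mem_region_iff.1 (hγ t)
      exact ⟨q, ⟨⟨h1, h2⟩, fun hc => h ⟨q, ⟨⟨h1, h2⟩, hc⟩, hq⟩⟩, hq⟩
    · rintro ⟨q, ⟨hq, hn⟩, hqt⟩ ⟨q', ⟨hq', hc⟩, hqt'⟩
      exact hn (hc.trans (hadj t q' q hq' hq hqt' hqt))
  have hclopen : IsClopen (γ ⁻¹' ⋃ q ∈ Z, D.square q) := by
    refine ⟨hclosed Z fun q hq => hq.1, ?_⟩
    rw [← isClosed_compl_iff, hcompl]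
    exact hclosed Z' fun q hq => hq.1
  have huniv := hclopen.eq_univ ⟨0, by
    simp only [Set.mem_preimage, Set.mem_iUnion, Path.source]
    exact ⟨a, ⟨ha, .refl⟩, hxa⟩⟩
  have h1 : (1 : unitInterval) ∈ γ ⁻¹' ⋃ q ∈ Z, D.square q := huniv ▸ Set.mem_univ _
  simp only [Set.mem_preimage, Set.mem_iUnion, exists_prop] at h1
  obtain ⟨q, ⟨hq, hc⟩, hq1⟩ := h1
  exact hc.trans (hadj 1 q b hq hb hq1 (by rwa [Path.target]))

/-- `U` is the trace on the region of an open set of the plane, which contains a whole thickening of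
the compact set `K`. -/
theorem exists_forall_square_subset {U : Set (ℝ × ℝ)}
    (hopen : IsOpen ((↑) ⁻¹' U : Set D.region)) {K : Set (ℝ × ℝ)} (hK : IsCompact K)
    (hKU : K ⊆ U) (hUD : U ⊆ D.region) :
    ∃ δ > 0, ∀ y ∈ D.region, ∀ x ∈ K, dist y x < δ → y ∈ U := by
  obtain ⟨O, hO, hOU⟩ := isOpen_induced_iff.1 hopen
  have hiff : ∀ y ∈ D.region, y ∈ O ↔ y ∈ U := fun y hy =>
    Set.ext_iff.1 hOU ⟨y, hy⟩
  obtain ⟨δ, hδ, h⟩ := hK.exists_thickening_subset_open hO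
    fun x hx => (hiff x (hUD (hKU hx))).2 (hKU hx)
  exact ⟨δ, hδ, fun y hy x hx hyx => (hiff y hy).1 (h (Metric.mem_thickening_iff.2 ⟨x, hx, hyx⟩))⟩

end UniformGrid

/-! ### From injections to transport plans -/

open Classical in
/-- An injection of the complement of `A` into the complement of `B`, as a 0/1 matrix. -/
theorem exists_matrix_of_injective {V : Type*} [Fintype V] (A B : Finset V)
    (f : {j // j ∉ A} → V) (hf : Function.Injective f) (hfB : ∀ j, f j ∉ B) :
    ∃ P : Matrix V V ℝ, (∀ i j, P i j = 0 ∨ P i j = 1) ∧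
      (∀ j, ∑ i, P i j = if j ∈ A then 0 else 1) ∧
      (∀ i, ∑ j, P i j ≤ if i ∈ B then 0 else 1) ∧
      ∀ i j, P i j = 1 → ∃ h : j ∉ A, f ⟨j, h⟩ = i := by
  refine ⟨fun i j => if ∃ h : j ∉ A, f ⟨j, h⟩ = i then 1 else 0, fun i j => ?_, fun j => ?_,
    fun i => ?_, fun i j h => ?_⟩
  · dsimp only
    split_ifs <;> simp
  · split_ifs with hj
    · simp [hj]
    · rw [Finset.sum_eq_single (f ⟨j, hj⟩)]
      · simp [hj]
      · intro i _ hi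
        refine if_neg ?_
        rintro ⟨_, rfl⟩
        exact hi rfl
      · simp
  · by_cases hi : ∃ j, f j = i
    · obtain ⟨j, rfl⟩ := hi
      rw [if_neg (hfB j), Finset.sum_eq_single (j : V)]
      · dsimp only
        split_ifs <;> simp
      · intro j' _ hj'
        refine if_neg ?_
        rintro ⟨_, h⟩
        exact hj' (congrArg Subtype.val (hf h))
      · simp
    · rw [Finset.sum_eq_zero]
      · split_ifs <;> simp
      · intro j _
        refine if_neg ?_
        rintro ⟨h, rfl⟩
        exact hi ⟨_, rfl⟩
  · by_contra hcon
    simp [hcon] at h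

namespace UniformGrid

variable {D : UniformGrid} {Ω κ : Set (ℝ × ℝ)}

/-- A one-step transition between edge-sharing unblocked cells. -/
def Cell.Step (κ : Set (ℝ × ℝ)) (i j : D.Cell Ω) : Prop :=
  i.ShareEdge j ∧ ¬ i.Blocked κ ∧ ¬ j.Blocked κ

theorem Cell.Step.symm {i j : D.Cell Ω} (h : i.Step κ j) : j.Step κ i := by
  refine ⟨?_, h.2.2, h.2.1⟩
  have := h.1
  simp only [Cell.ShareEdge] at this ⊢
  omega

theorem IsTransitionCost.le_one {C : Matrix (D.Cell Ω) (D.Cell Ω) ℝ≥0∞}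
    (hC : D.IsTransitionCost Ω κ C) {i j : D.Cell Ω} (h : i = j ∨ i.Step κ j) : C i j ≤ 1 := by
  rcases h with rfl | h
  · rw [hC.stay]; exact zero_le_one
  · exact hC.step i j h.1 h.2.1 h.2.2

theorem PracticallyFeasible.of_matrix {N M : ℕ} {p : Fin N → ℝ × ℝ} {r : Fin M → ℝ × ℝ}
    {C : Matrix (D.Cell Ω) (D.Cell Ω) ℝ≥0∞} (P : Matrix (D.Cell Ω) (D.Cell Ω) ℝ)
    (h01 : ∀ i j, P i j = 0 ∨ P i j = 1) (hC : ∀ i j, P i j = 1 → C i j ≤ 1)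
    (hrow : ∀ i, ∑ j, P i j ≤ D.source Ω r i) (hcol : ∀ j, ∑ i, P i j ≤ D.sink Ω p j)
    (heq : (∀ i, ∑ j, P i j = D.source Ω r i) ∨ ∀ j, ∑ i, P i j = D.sink Ω p j)
    (hNM : N = M → ∑ i, D.source Ω r i = ∑ i, D.sink Ω p i) :
    D.PracticallyFeasible Ω p r C := by
  have hcomm : ∑ i, ∑ j, P i j = ∑ j, ∑ i, P i j := Finset.sum_comm
  have hr : ∑ i, ∑ j, P i j ≤ ∑ i, D.source Ω r i := Finset.sum_le_sum fun i _ => hrow i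
  have hc : ∑ j, ∑ i, P i j ≤ ∑ i, D.sink Ω p i := Finset.sum_le_sum fun i _ => hcol i
  have htot : ∑ i, ∑ j, P i j = min (∑ i, D.source Ω r i) (∑ i, D.sink Ω p i) := by
    refine le_antisymm (le_min hr (hcomm ▸ hc)) ?_
    rcases heq with h | h
    · rw [Finset.sum_congr rfl fun i _ => h i]
      exact min_le_left _ _
    · rw [hcomm, Finset.sum_congr rfl fun i _ => h i]
      exact min_le_right _ _
  refine ⟨P, h01, ?_, ⟨hrow, hcol, htot, fun h i => ?_, fun h j => ?_⟩, hC⟩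
  · refine ENNReal.sum_lt_top.2 fun i _ => ENNReal.sum_lt_top.2 fun j _ => ?_
    rcases h01 i j with h | h
    · simp [h]
    · rw [h, ENNReal.ofReal_one, one_mul]
      exact (hC i j h).trans_lt ENNReal.one_lt_top
  -- Termwise inequalities with equal totals are equalities.
  · rw [hNM h, min_self, ← hNM h] at htot
    exact (Finset.sum_eq_sum_iff_of_le fun i _ => hrow i).1 htot i (Finset.mem_univ i)
  · rw [hNM h, min_self, hcomm] at htot
    exact (Finset.sum_eq_sum_iff_of_le fun i _ => hcol i).1 htot j (Finset.mem_univ j)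

open Classical Finset in
/-- Feasibility from an injection of the cells without robots (or targets) into the cells without
targets (or robots) that moves each cell by at most one step. -/
theorem PracticallyFeasible.of_injective {N M : ℕ} {p : Fin N → ℝ × ℝ} {r : Fin M → ℝ × ℝ}
    {C : Matrix (D.Cell Ω) (D.Cell Ω) ℝ≥0∞} (hC : D.IsTransitionCost Ω κ C)
    {A B : Finset (D.Cell Ω)} (hA : ∀ i, i ∈ A ↔ ∃ n, p n ∈ i.carrier)
    (hB : ∀ i, i ∈ B ↔ ∃ m, r m ∈ i.carrier) (hNM : N = M → #A = #B)
    (h : (∃ f : {j // j ∉ A} → D.Cell Ω, Function.Injective f ∧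
        ∀ j, f j ∉ B ∧ (f j = j ∨ Cell.Step κ (j : D.Cell Ω) (f j))) ∨
      ∃ f : {j // j ∉ B} → D.Cell Ω, Function.Injective f ∧
        ∀ j, f j ∉ A ∧ (f j = j ∨ Cell.Step κ (j : D.Cell Ω) (f j))) :
    D.PracticallyFeasible Ω p r C := by
  have hsource : ∀ i, D.source Ω r i = if i ∈ B then 0 else 1 := fun i => by
    rw [source]; simp only [hB]
  have hsink : ∀ i, D.sink Ω p i = if i ∈ A then 0 else 1 := fun i => by
    rw [sink]; simp only [hA]
  have hsum : ∀ s : Finset (D.Cell Ω), ∑ i, (if i ∈ s then (0 : ℝ) else 1) =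
      Fintype.card (D.Cell Ω) - #s := by
    intro s
    have h1 : ∀ i, (if i ∈ s then (0 : ℝ) else 1) = 1 - if i ∈ s then 1 else 0 := by
      intro i; split_ifs <;> simp
    rw [sum_congr rfl fun i _ => h1 i, sum_sub_distrib]
    simp
  have hNM' : N = M → ∑ i, D.source Ω r i = ∑ i, D.sink Ω p i := by
    intro h
    rw [sum_congr rfl fun i _ => hsource i, sum_congr rfl fun i _ => hsink i, hsum, hsum, hNM h]
  rcases h with ⟨f, hf, hf'⟩ | ⟨f, hf, hf'⟩
  · obtain ⟨P, h01, hc, hr, h1⟩ := exists_matrix_of_injective A B f hf fun j => (hf' j).1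
    refine .of_matrix P h01 (fun i j hij => hC.le_one ?_) (fun i => ?_) (fun j => ?_)
      (Or.inr fun j => ?_) hNM'
    · obtain ⟨h, rfl⟩ := h1 i j hij
      exact (hf' ⟨j, h⟩).2.imp id Cell.Step.symm
    · rw [hsource]; convert hr i
    · rw [hsink]; convert (hc j).le
    · rw [hsink]; convert hc j
  · obtain ⟨P, h01, hc, hr, h1⟩ := exists_matrix_of_injective B A f hf fun j => (hf' j).1
    refine .of_matrix P.transpose (fun i j => h01 j i) (fun i j hij => hC.le_one ?_) (fun i => ?_)
      (fun j => ?_) (Or.inl fun i => ?_) hNM'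
    · obtain ⟨h, rfl⟩ := h1 j i hij
      exact (hf' ⟨i, h⟩).2.imp Eq.symm id
    · rw [hsource]; simpa only [Matrix.transpose_apply] using (hc i).le
    · rw [hsink]; simpa only [Matrix.transpose_apply] using hr j
    · rw [hsource]; simpa only [Matrix.transpose_apply] using hc i

theorem Cell.not_blocked_iff {i : D.Cell Ω} : ¬ i.Blocked κ ↔ i.index ∈ D.freeSquares (Ω \ κ) := by
  rw [Cell.Blocked, not_not, Cell.carrier_eq]
  exact ⟨fun h => ⟨i.1.1.2, i.1.2.2, h⟩, fun h => h.2.2⟩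

theorem square_nonempty (q : ℕ × ℕ) : (D.square q).Nonempty :=
  Set.Nonempty.prod
    (Set.nonempty_Icc.2 (by nlinarith [D.width_pos]))
    (Set.nonempty_Icc.2 (by nlinarith [D.height_pos]))

theorem exists_cell_of_mem_freeSquares {q : ℕ × ℕ} (h : q ∈ D.freeSquares (Ω \ κ)) :
    ∃ i : D.Cell Ω, i.index = q ∧ ¬ i.Blocked κ := by
  obtain ⟨x, hx⟩ := D.square_nonempty q
  exact ⟨Cell.mk h.1 h.2.1 ⟨x, hx, (h.2.2 hx).1⟩, rfl, Cell.not_blocked_iff.2 h⟩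

open Finset in
/-- Sets of cells of a fine grid in different boxes of a coarse grid, connected through chains of
unblocked boxes of the coarse grid. -/
theorem exists_injective_of_chain {L : ℕ} (hL : 0 < L) {A B : Finset ((D.subdivide L hL).Cell Ω)}
    (hAB : Disjoint A B)
    (hinj : ∀ i, i ∈ A ∨ i ∈ B → ∀ j, j ∈ A ∨ j ∈ B →
      blockOf L i.index = blockOf L j.index → i = j)
    (hF : ∀ i, i ∈ A ∨ i ∈ B → blockOf L i.index ∈ D.freeSquares (Ω \ κ))
    (hchain : ∀ a ∈ A, ∀ b ∈ B, Relation.ReflTransGen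
      (fun q q' => q ∈ D.freeSquares (Ω \ κ) ∧ q' ∈ D.freeSquares (Ω \ κ) ∧ EdgeAdj q q')
      (blockOf L b.index) (blockOf L a.index))
    (hcard : #B ≤ #A) (hBL : 2 * #B ≤ L) :
    ∃ f : {j // j ∉ A} → (D.subdivide L hL).Cell Ω, Function.Injective f ∧
      ∀ j, f j ∉ B ∧ (f j = j ∨ Cell.Step κ (j : (D.subdivide L hL).Cell Ω) (f j)) := by
  classical
  refine exists_injective_of_card_inter_le (Cell.Step κ) A B fun T hAT => ?_
  set S : Finset ((D.subdivide L hL).Cell Ω) := {y | y ∉ T ∧ ∃ x ∈ T, Cell.Step κ x y} with hS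
  have hidx := Cell.index_injective (D := D.subdivide L hL) (Ω := Ω)
  have hcardi : ∀ s : Finset ((D.subdivide L hL).Cell Ω), #(s.image Cell.index) = #s :=
    fun s => card_image_of_injective s hidx
  have key := card_inter_le_of_blocks (L := L) (F := D.freeSquares (Ω \ κ))
    (S := S.image Cell.index) (T := T.image Cell.index) (A := A.image Cell.index)
    (B := B.image Cell.index) ?_ ?_ ?_ ?_ ?_ ?_ ?_ ?_ ?_
  · rwa [← image_inter _ _ hidx, ← image_sdiff _ _ hidx, hcardi, hcardi] at key
  · intro x y hx hy hxy hxT hyT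
    obtain ⟨j, rfl, hj⟩ := exists_cell_of_mem_freeSquares (mem_freeSquares_subdivide hL hy)
    obtain ⟨i, hi, rfl⟩ := mem_image.1 hxT
    refine mem_image_of_mem _ ?_
    rw [hS, mem_filter]
    exact ⟨mem_univ _, fun h => hyT (mem_image_of_mem _ h), i, hi, Cell.shareEdge_iff.2 hxy,
      Cell.not_blocked_iff.2 (mem_freeSquares_subdivide hL hx), hj⟩
  · rw [disjoint_image hidx, disjoint_left]
    intro i hi
    rw [hS, mem_filter] at hi
    exact hi.2.1
  · rwa [disjoint_image hidx]
  · rwa [disjoint_image hidx]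
  · rw [← image_union]
    simp only [forall_mem_image, mem_union]
    intro i hi j hj h
    rw [hinj i hi j hj h]
  · rw [← image_union]
    simp only [forall_mem_image, mem_union]
    exact hF
  · simpa only [forall_mem_image] using hchain
  · rwa [hcardi, hcardi]
  · rwa [hcardi]

/-! ### Properties of all sufficiently fine subdivisions -/

theorem tendsto_max_size (D : UniformGrid) : Filter.Tendsto
    (fun k : ℕ => max (D.width / k) (D.height / k)) Filter.atTop (nhds 0) := by
  simpa using (tendsto_const_div_atTop_nhds_zero_nat D.width).max
    (tendsto_const_div_atTop_nhds_zero_nat D.height)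

/-- In a fine subdivision, all boxes that meet a path in a relatively open set lie in the set. -/
theorem eventually_square_subset {U : Set (ℝ × ℝ)}
    (hopen : IsOpen ((↑) ⁻¹' U : Set D.region)) (hUD : U ⊆ D.region) {x y : ℝ × ℝ} (γ : Path x y)
    (hγ : ∀ t, γ t ∈ U) :
    ∀ᶠ k : ℕ in Filter.atTop, ∀ hk : 0 < k, ∀ t q, q.1 < (D.subdivide k hk).cols →
      q.2 < (D.subdivide k hk).rows → γ t ∈ (D.subdivide k hk).square q →
        (D.subdivide k hk).square q ⊆ U := by
  obtain ⟨δ, hδ, h⟩ := exists_forall_square_subset hopen (isCompact_range γ.continuous)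
    (Set.range_subset_iff.2 hγ) hUD
  filter_upwards [D.tendsto_max_size.eventually_lt_const hδ] with k hkδ hk t q h1 h2 ht z hz
  refine h z ?_ (γ t) (Set.mem_range_self t) ((dist_le_of_mem_square hz ht).trans_lt hkδ)
  rw [← region_subdivide hk]
  exact square_subset_region h1 h2 hz

/-- In a fine subdivision, no box contains two different points of a finite family. -/
theorem eventually_eq_of_mem_square (D : UniformGrid) {s : Set (ℝ × ℝ)} (hs : s.Finite) :
    ∀ᶠ k : ℕ in Filter.atTop, ∀ hk : 0 < k, ∀ x ∈ s, ∀ y ∈ s, ∀ q,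
      x ∈ (D.subdivide k hk).square q → y ∈ (D.subdivide k hk).square q → x = y := by
  have : ∀ᶠ k : ℕ in Filter.atTop, ∀ x ∈ s, ∀ y ∈ s, x ≠ y →
      max (D.width / k) (D.height / k) < dist x y := by
    rw [Filter.eventually_all_finite hs]
    intro x _
    rw [Filter.eventually_all_finite hs]
    intro y _
    by_cases hxy : x = y
    · exact .of_forall fun _ h => absurd hxy h
    · filter_upwards [D.tendsto_max_size.eventually_lt_const (dist_pos.2 hxy)] with k hk _ using hk
  filter_upwards [this] with k h hk x hx y hy q hxq hyq
  by_contra hxy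
  exact (h x hx y hy hxy).not_ge (dist_le_of_mem_square hxq hyq)

end UniformGrid

end

/-! ### The two refinements combined -/

theorem lemma2 {N M : ℕ} (D : UniformGrid) (Ω κ : Set (ℝ × ℝ))
    (p : Fin N → ℝ × ℝ) (r : Fin M → ℝ × ℝ)
    (hκ : κ ⊆ Ω)
    (hopen : IsOpen ((↑) ⁻¹' (Ω \ κ) : Set D.region))
    (hp : ∀ n, p n ∈ Ω) (hr : ∀ m, r m ∈ Ω)
    (hD : D.IsDiscretization Ω p r)
    (hpath : ∀ n m, ∃ γ : Path (p n) (r m), ∀ t,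
      γ t ∈ Ω \ κ ∧ (∀ n', n' ≠ n → γ t ≠ p n') ∧ (∀ m', m' ≠ m → γ t ≠ r m')) :
    ∃ (k : ℕ) (hk : 1 < k),
      (D.subdivide k (Nat.zero_lt_of_lt hk)).IsDiscretization Ω p r ∧
      (D.subdivide k (Nat.zero_lt_of_lt hk)).Separates Ω p r ∧
      ∀ C : Matrix ((D.subdivide k (Nat.zero_lt_of_lt hk)).Cell Ω)
          ((D.subdivide k (Nat.zero_lt_of_lt hk)).Cell Ω) ℝ≥0∞,
        (D.subdivide k (Nat.zero_lt_of_lt hk)).IsTransitionCost Ω κ C →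
        (D.subdivide k (Nat.zero_lt_of_lt hk)).PracticallyFeasible Ω p r C := by
  classical
  obtain ⟨hΩ, -, -⟩ := id hD
  have hUD : Ω \ κ ⊆ D.region := Set.sdiff_subset.trans hΩ
  choose γ hγ using hpath
  have hev := (D.eventually_eq_of_mem_square ((Set.finite_range p).union (Set.finite_range r))).and
    (Filter.eventually_all.2 fun n => Filter.eventually_all.2 fun m =>
      UniformGrid.eventually_square_subset hopen hUD (γ n m) fun t => (hγ n m t).1)
  obtain ⟨k₀, hk₀⟩ := Filter.eventually_atTop.1 hev
  obtain ⟨k, hk, hk₀k, hDk⟩ := hD.exists_subdivide hp hr k₀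
  obtain ⟨hsep, hfree⟩ := hk₀ k hk₀k.le
  replace hsep := hsep hk
  replace hfree := fun n m => hfree n m hk
  have hreg : (D.subdivide k hk).region = D.region := UniformGrid.region_subdivide hk
  -- `2 * (N + M)` serves the bound on twice the number of robot or target cells; the extra `1`
  -- gives `1 < k * L` even without robots and targets.
  obtain ⟨L, hL, hNML, hDL⟩ := hDk.exists_subdivide hp hr (2 * (N + M) + 1)
  have hkL : 1 < k * L := by nlinarith
  refine ⟨k * L, hkL, ?_⟩
  rw [← UniformGrid.subdivide_subdivide hk hL]
  set E := D.subdivide k hk with hE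
  have hsub : ∀ i : (E.subdivide L hL).Cell Ω, i.carrier ⊆ E.square (blockOf L i.index) :=
    fun i => UniformGrid.square_subdivide_subset hL i.index
  have hpm : ∀ n, p n ∈ Set.range p ∪ Set.range r := fun n => Or.inl ⟨n, rfl⟩
  have hrm : ∀ m, r m ∈ Set.range p ∪ Set.range r := fun m => Or.inr ⟨m, rfl⟩
  have hSep : (E.subdivide L hL).Separates Ω p r := fun i x hx y hy =>
    hsep x hx.2 y hy.2 _ (hsub i hx.1) (hsub i hy.1)
  refine ⟨hDL, hSep, fun C hC => ?_⟩
  choose cp hcp hcpu using hDL.2.1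
  choose cr hcr hcru using hDL.2.2
  have hblock : ∀ i : (E.subdivide L hL).Cell Ω,
      (blockOf L i.index).1 < E.cols ∧ (blockOf L i.index).2 < E.rows := fun i =>
    ⟨(Nat.div_lt_iff_lt_mul hL).2 i.1.1.2, (Nat.div_lt_iff_lt_mul hL).2 i.1.2.2⟩
  -- Distinctness of the robots comes from the paths, hence needs a target: a path from `p n` must
  -- avoid the other robots already at its start.
  have hpinj : ∀ m : Fin M, Function.Injective p := by
    intro m n n' h
    by_contra hne
    exact (hγ n m 0).2.1 n' (Ne.symm hne) (by rw [Path.source, h])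
  have hrinj : ∀ n : Fin N, Function.Injective r := by
    intro n m m' h
    by_contra hne
    exact (hγ n m 1).2.2 m' (Ne.symm hne) (by rw [Path.target, h])
  have hcpinj : ∀ m : Fin M, Function.Injective cp := by
    intro m n n' h
    exact hpinj m (hSep (cp n) ⟨hcp n, hpm n⟩ ⟨h ▸ hcp n', hpm n'⟩)
  have hcrinj : ∀ n : Fin N, Function.Injective cr := by
    intro n m m' h
    exact hrinj n (hSep (cr m) ⟨hcr m, hrm m⟩ ⟨h ▸ hcr m', hrm m'⟩)
  have hA : ∀ i, i ∈ Finset.univ.image cp ↔ ∃ n, p n ∈ i.carrier := fun i => by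
    simp only [Finset.mem_image, Finset.mem_univ, true_and]
    exact exists_congr fun n => ⟨fun h => h ▸ hcp n, fun h => (hcpu n i h).symm⟩
  have hB : ∀ i, i ∈ Finset.univ.image cr ↔ ∃ m, r m ∈ i.carrier := fun i => by
    simp only [Finset.mem_image, Finset.mem_univ, true_and]
    exact exists_congr fun m => ⟨fun h => h ▸ hcr m, fun h => (hcru m i h).symm⟩
  have hcardA : (Finset.univ.image cp).card ≤ N := Finset.card_image_le.trans (by simp)
  have hcardB : (Finset.univ.image cr).card ≤ M := Finset.card_image_le.trans (by simp)
  refine UniformGrid.PracticallyFeasible.of_injective hC hA hB ?_ ?_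
  · rintro rfl
    rcases N.eq_zero_or_pos with rfl | hN
    · simp
    · rw [Finset.card_image_of_injective _ (hcpinj ⟨0, hN⟩),
        Finset.card_image_of_injective _ (hcrinj ⟨0, hN⟩)]
  set A := Finset.univ.image cp with hAdef
  set B := Finset.univ.image cr with hBdef
  -- If one set contains the other, nothing has to move. Otherwise both are nonempty, so a robot and
  -- a target exist.
  by_cases hBA : B ⊆ A
  · exact Or.inl ⟨Subtype.val, Subtype.val_injective, fun j => ⟨fun h => j.2 (hBA h), Or.inl rfl⟩⟩
  by_cases hAsub : A ⊆ B
  · exact Or.inr ⟨Subtype.val, Subtype.val_injective, fun j => ⟨fun h => j.2 (hAsub h), Or.inl rfl⟩⟩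
  have memA : ∀ {i}, i ∈ A → ∃ n, cp n = i := fun h => by simpa [hAdef] using h
  have memB : ∀ {i}, i ∈ B → ∃ m, cr m = i := fun h => by simpa [hBdef] using h
  obtain ⟨i₀, hi₀, -⟩ := Finset.not_subset.1 hAsub
  obtain ⟨n₀, -⟩ := memA hi₀
  obtain ⟨j₀, hj₀, -⟩ := Finset.not_subset.1 hBA
  obtain ⟨m₀, -⟩ := memB hj₀
  have hdisj : Disjoint A B := by
    rw [Finset.disjoint_left]
    intro i hiA hiB
    obtain ⟨n, rfl⟩ := memA hiA
    obtain ⟨m, hm⟩ := memB hiB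
    have hpr : p n = r m := hSep (cp n) ⟨hcp n, hpm n⟩ ⟨hm ▸ hcr m, hrm m⟩
    -- Were robot `n` at target `m`, the path of any other robot to `r m` would end at `p n`, which
    -- is forbidden; so `n` would be the only robot and `A ⊆ B`.
    refine hAsub fun j hj => ?_
    obtain ⟨n', rfl⟩ := memA hj
    by_cases hn : n' = n
    · rw [hn]; exact hiB
    · exact absurd (by rw [Path.target, hpr]) ((hγ n' m 1).2.1 n (Ne.symm hn))
  have hmem : ∀ i, i ∈ A ∨ i ∈ B → ∃ x ∈ Set.range p ∪ Set.range r, x ∈ i.carrier ∧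
      (∀ j : (E.subdivide L hL).Cell Ω, x ∈ j.carrier → j = i) ∧
      blockOf L i.index ∈ E.freeSquares (Ω \ κ) := by
    rintro i (hi | hi)
    · obtain ⟨n, rfl⟩ := memA hi
      refine ⟨p n, hpm n, hcp n, hcpu n, (hblock _).1, (hblock _).2,
        hfree n m₀ 0 _ (hblock _).1 (hblock _).2 ?_⟩
      rw [Path.source]
      exact hsub _ (hcp n)
    · obtain ⟨m, rfl⟩ := memB hi
      refine ⟨r m, hrm m, hcr m, hcru m, (hblock _).1, (hblock _).2,
        hfree n₀ m 1 _ (hblock _).1 (hblock _).2 ?_⟩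
      rw [Path.target]
      exact hsub _ (hcr m)
  have hinj : ∀ i, i ∈ A ∨ i ∈ B → ∀ j, j ∈ A ∨ j ∈ B →
      blockOf L i.index = blockOf L j.index → i = j := by
    intro i hi j hj hij
    obtain ⟨x, hx, hxi, hxu, -⟩ := hmem i hi
    obtain ⟨y, hy, hyj, -⟩ := hmem j hj
    obtain rfl := hsep x hx y hy _ (hsub i hxi) (hij ▸ hsub j hyj)
    exact (hxu j hyj).symm
  have hF : ∀ i, i ∈ A ∨ i ∈ B → blockOf L i.index ∈ E.freeSquares (Ω \ κ) := fun i hi =>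
    (hmem i hi).choose_spec.2.2.2
  have hchain : ∀ a ∈ A, ∀ b ∈ B, Relation.ReflTransGen
      (fun q q' => q ∈ E.freeSquares (Ω \ κ) ∧ q' ∈ E.freeSquares (Ω \ κ) ∧ EdgeAdj q q')
      (blockOf L a.index) (blockOf L b.index) := by
    intro a ha b hb
    obtain ⟨n, rfl⟩ := memA ha
    obtain ⟨m, rfl⟩ := memB hb
    exact UniformGrid.reflTransGen_of_path (γ n m) (fun t => hreg ▸ hUD (hγ n m t).1) (hfree n m)
      (hblock _) (hsub _ (hcp n)) (hblock _) (hsub _ (hcr m))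
  rcases le_total B.card A.card with hcard | hcard
  · refine Or.inl (UniformGrid.exists_injective_of_chain hL hdisj hinj hF (fun a ha b hb => ?_)
      hcard (by omega))
    have : Std.Symm fun q q' => q ∈ E.freeSquares (Ω \ κ) ∧ q' ∈ E.freeSquares (Ω \ κ) ∧
        EdgeAdj q q' := ⟨fun q q' h => ⟨h.2.1, h.1, h.2.2.symm⟩⟩
    exact Relation.ReflTransGen.stdSymm.symm _ _ (hchain a ha b hb)
  · exact Or.inr (UniformGrid.exists_injective_of_chain hL hdisj.symm
      (fun i hi j hj => hinj i hi.symm j hj.symm) (fun i hi => hF i hi.symm)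
      (fun b hb a ha => hchain a ha b hb) hcard (by omega))
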